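/- Let $f(m)=-\tfrac23 m^{3/2}$ for $m\ge 0$, let $\mathbb{R}_+=(0,\infty)$ and $\Omega=\mathbb{R}^2_+=(0,\infty)\times(0,\infty)$, with points written $(x,t)$. Let $m_0\in L^\infty(\mathbb{R}_+)$ satisfy $m_0\ge 0$ and $m_0(x+h)\ge m_0(x)$ for all $x>0$ and $h>0$. Then there is one and, up to equality almost everywhere in $\Omega$, only one function $m\in L^\infty(\Omega)$ with $m\ge 0$ that is a weak solution of the conservation law $$m_{t}+f(m)_{x}=0 \quad\text{on } \Omega,\qquad m(x,0)=m_0(x),$$ and satisfies $m(x+h,t)\ge m(x,t)$ for all $h>0$ and all $(x,t)\in\Omega$. Here a weak solution with initial values $m_0$ is one for which $$\int_\Omega\bigl(m\,\psi_{t}+f(m)\,\psi_{x}\bigr)\,dx\,dt+\int_0^\infty m_0(x)\,\psi(x,0)\,dx=0$$ for every $\psi\in C^\infty_0\bigl((0,\infty)\times\mathbb{R}\bigr)$; no condition is imposed on the boundary $x=0$. -/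

import Mathlib

open MeasureTheory Set
open scoped ContDiff

namespace ShellCrossing

noncomputable section

/-- The flux `f(m) = -(2/3) m^{3/2}`; it is only applied to values `m ≥ 0`. -/
def flux (m : ℝ) : ℝ := -(2 / 3) * m ^ (3 / 2 : ℝ)

/-- The open quadrant `{(x, t) : x > 0, t > 0}`. -/
def quadrant : Set (ℝ × ℝ) := Ioi 0 ×ˢ Ioi 0

/-- Test functions for the initial value problem on the quadrant: (restrictions to `t ≥ 0` of)
smooth functions of `(x, t)` whose compact support lies in `{x > 0}`. They vanish near `x = 0`
but need not vanish at `t = 0`. -/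
structure IsTestFunction (ψ : ℝ × ℝ → ℝ) : Prop where
  smooth : ContDiff ℝ ∞ ψ
  compactSupport : HasCompactSupport ψ
  support_subset : tsupport ψ ⊆ Ioi 0 ×ˢ univ

/-- `m` is a (nonnegative) `L^∞` weak solution of `m_t + f(m)_x = 0` on the quadrant with initial
values `m₀` at `t = 0`:
`∬ (m ψ_t + f(m) ψ_x) dx dt + ∫ m₀(x) ψ(x, 0) dx = 0` for every test function `ψ`. -/
structure IsWeakSolution (m₀ : ℝ → ℝ) (m : ℝ × ℝ → ℝ) : Prop where
  memLp : MemLp m ⊤ (volume.restrict quadrant)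
  nonneg : ∀ p ∈ quadrant, 0 ≤ m p
  weak_eq : ∀ ψ : ℝ × ℝ → ℝ, IsTestFunction ψ →
    (∫ p in quadrant, (m p * deriv (fun t => ψ (p.1, t)) p.2
        + flux (m p) * deriv (fun x => ψ (x, p.2)) p.1))
      + ∫ x in Ioi (0 : ℝ), m₀ x * ψ (x, 0) = 0

/-- A weak solution with `m(x + h, t) ≥ m(x, t)` for all `h > 0` and all `x, t > 0`. -/
structure IsPositiveDensitySolution (m₀ : ℝ → ℝ) (m : ℝ × ℝ → ℝ) : Prop where
  isWeakSolution : IsWeakSolution m₀ m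
  mono : ∀ x t h : ℝ, 0 < x → 0 < t → 0 < h → m (x, t) ≤ m (x + h, t)

end

end ShellCrossing

/-!
Existence. Put `F = -f`. The initial density, which is nondecreasing, has a convex primitive, which
is therefore a supremum of lines. Letting each line of slope `p` rise with speed `F p` gives a
supremum of planes (Hopf's formula), a convex potential `U` with `U_t = F (U_x)` almost everywhere.
The slopes of supporting planes furnish a version of `m = U_x` that is nondecreasing in `x` at
every time, and the weak equation is the symmetry of the second derivatives of `U`, the initial
values entering through the trace of `U` at `t = 0`.

Uniqueness. The difference `δ` of two solutions `n` and `k` satisfies `δ_t = (b δ)_x`, where `b` is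
the mean of `F' = √·` between `k` and `n`; it is nonnegative, bounded and, because `n` and `k` are,
nondecreasing in `x`. Choose `W` with `W_x = δ` and `W_t = b δ`, vanishing at `t = 0`. Then
`(W²)_t = b (W²)_x`, where `b ≥ 0` means that nothing enters through the boundary `x = 0` and the
monotonicity of `b` means that integrating the right side by parts gives a term `-∫ b_x W² ≤ 0`. So
the integral of `W²` over the slices of a backward cone does not increase and `W`, hence `δ`,
vanishes. As `δ` is merely bounded, this is carried out for mollifications `D` of `δ` and `G` of
`b δ`, whose potential satisfies the equation up to the defect `G - b D`, which tends to `0` in `L¹`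
on bounded sets.
-/

namespace ShellCrossing

open Filter Topology Real

section SlopeField

/-- `n` assigns to every point the `x`-slope of a supporting plane of the potential `U` whose
`t`-slope is `F` of its `x`-slope. Where `U` is differentiable this says that `U_x = n` and
`U_t = F n`, so that `n` solves `n_t = F(n)_x`; unlike `U_x` it is defined everywhere. -/
def IsSlopeField (F : ℝ → ℝ) (U n : ℝ × ℝ → ℝ) : Prop :=
  ∀ z w : ℝ × ℝ, U z + n z * (w.1 - z.1) + F (n z) * (w.2 - z.2) ≤ U w

variable {F : ℝ → ℝ} {U n : ℝ × ℝ → ℝ} {K : Set ℝ}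

lemma IsSlopeField.monotone_fst (h : IsSlopeField F U n) (t : ℝ) :
    Monotone fun x => n (x, t) := by
  intro x y hxy
  rcases hxy.eq_or_lt with rfl | hlt
  · exact le_rfl
  · have hforward := h (x, t) (y, t)
    have hbackward := h (y, t) (x, t)
    dsimp only at hforward hbackward ⊢
    nlinarith

lemma IsSlopeField.exists_lipschitzWith (h : IsSlopeField F U n) (hK : IsCompact K)
    (hF : ContinuousOn F K) (hn : ∀ z, n z ∈ K) : ∃ C, LipschitzWith C U := by
  obtain ⟨A, hA⟩ := hK.exists_bound_of_continuousOn continuousOn_id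
  obtain ⟨B, hB⟩ := hK.exists_bound_of_continuousOn hF
  refine ⟨(A + B).toNNReal, LipschitzWith.of_le_add_mul _ fun z w => ?_⟩
  have hfst : |n z * (w.1 - z.1)| ≤ A * dist z w := by
    rw [abs_mul, abs_sub_comm]
    exact mul_le_mul (hA _ (hn z)) (le_max_left _ _) (abs_nonneg _)
      ((norm_nonneg _).trans (hA _ (hn z)))
  have hsnd : |F (n z) * (w.2 - z.2)| ≤ B * dist z w := by
    rw [abs_mul, abs_sub_comm]
    exact mul_le_mul (hB _ (hn z)) (le_max_right _ _) (abs_nonneg _)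
      ((norm_nonneg _).trans (hB _ (hn z)))
  have hcoe : (A + B) * dist z w ≤ (A + B).toNNReal * dist z w :=
    mul_le_mul_of_nonneg_right (le_coe_toNNReal _) dist_nonneg
  linarith [h z w, neg_abs_le (n z * (w.1 - z.1)), neg_abs_le (F (n z) * (w.2 - z.2))]

lemma lineDeriv_eq_of_forall_add_mul_le {E : Type*} [NormedAddCommGroup E] [NormedSpace ℝ E]
    {f : E → ℝ} {z e : E} {c : ℝ} (hf : DifferentiableAt ℝ f z)
    (h : ∀ s : ℝ, f z + s * c ≤ f (z + s • e)) : lineDeriv ℝ f z e = c := by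
  have hderiv : HasDerivAt (fun s : ℝ => f (z + s • e) - s * c) (lineDeriv ℝ f z e - c) 0 := by
    have hline : HasDerivAt (fun s : ℝ => f (z + s • e)) (lineDeriv ℝ f z e) 0 :=
      hf.lineDifferentiableAt.hasLineDerivAt
    simpa only [one_mul] using hline.fun_sub ((hasDerivAt_id' (0 : ℝ)).mul_const c)
  have hmin : IsLocalMin (fun s : ℝ => f (z + s • e) - s * c) 0 :=
    Eventually.of_forall fun s => by
      simp only [zero_smul, add_zero, zero_mul, sub_zero]
      linarith [h s]
  exact sub_eq_zero.1 (hmin.hasDerivAt_eq_zero hderiv)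

lemma IsSlopeField.lineDeriv_eq (h : IsSlopeField F U n) {z : ℝ × ℝ}
    (hz : DifferentiableAt ℝ U z) :
    lineDeriv ℝ U z (1, 0) = n z ∧ lineDeriv ℝ U z (0, 1) = F (n z) := by
  constructor <;> refine lineDeriv_eq_of_forall_add_mul_le hz fun s => ?_
  · simpa [mul_comm] using h z (z + s • ((1, 0) : ℝ × ℝ))
  · simpa [mul_comm] using h z (z + s • ((0, 1) : ℝ × ℝ))

lemma IsSlopeField.aestronglyMeasurable (h : IsSlopeField F U n) {C : NNReal}
    (hU : LipschitzWith C U) : AEStronglyMeasurable n := by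
  refine (measurable_lineDeriv (𝕜 := ℝ) (v := ((1, 0) : ℝ × ℝ))
    hU.continuous).aestronglyMeasurable.congr ?_
  filter_upwards [hU.ae_differentiableAt] with z hz using (h.lineDeriv_eq hz).1

end SlopeField

section Hopf

/-- The primitive of `v` that vanishes at `0`. -/
noncomputable def primitive (v : ℝ → ℝ) (x : ℝ) : ℝ := ∫ s in (0 : ℝ)..x, v s

lemma primitive_add_mul_le {v : ℝ → ℝ} (hv : Monotone v) (x y : ℝ) :
    primitive v y + v y * (x - y) ≤ primitive v x := by
  have hi : ∀ a b : ℝ, IntervalIntegrable v volume a b := fun a b => hv.intervalIntegrable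
  have hsub : primitive v x - primitive v y = ∫ s in y..x, v s :=
    intervalIntegral.integral_interval_sub_left (hi _ _) (hi _ _)
  rcases le_total y x with hyx | hxy
  · have hle : ∫ _ in y..x, v y ≤ ∫ s in y..x, v s :=
      intervalIntegral.integral_mono_on hyx (by simp) (hi _ _) fun s hs => hv hs.1
    rw [intervalIntegral.integral_const, smul_eq_mul] at hle
    linarith
  · have hle : ∫ s in x..y, v s ≤ ∫ _ in x..y, v y :=
      intervalIntegral.integral_mono_on hxy (hi _ _) (by simp) fun s hs => hv hs.2
    rw [intervalIntegral.integral_symm] at hsub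
    rw [intervalIntegral.integral_const, smul_eq_mul] at hle
    linarith

/-- The plane with slopes `(v y, F (v y))` that touches the primitive of `v` at `(y, 0)`. -/
noncomputable def plane (F v : ℝ → ℝ) (y : ℝ) (z : ℝ × ℝ) : ℝ :=
  primitive v y + v y * (z.1 - y) + F (v y) * z.2

/-- Hopf's formula for the potential `U` of the conservation law `n_t = F(n)_x`, that is, for the
solution of `U_t = F(U_x)`, with increasing initial density `v`. -/
noncomputable def hopf (F v : ℝ → ℝ) (z : ℝ × ℝ) : ℝ := ⨆ y : ℝ, plane F v y z

variable {F v : ℝ → ℝ} {K : Set ℝ}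

lemma plane_zero_le_primitive (hv : Monotone v) (x y : ℝ) :
    plane F v y (x, 0) ≤ primitive v x := by
  simpa [plane] using primitive_add_mul_le hv x y

lemma hopf_zero (hv : Monotone v) (x : ℝ) : hopf F v (x, 0) = primitive v x := by
  refine le_antisymm (ciSup_le (plane_zero_le_primitive hv x)) ?_
  have hbdd : BddAbove (range fun y => plane F v y (x, 0)) :=
    ⟨primitive v x, forall_mem_range.2 (plane_zero_le_primitive hv x)⟩
  simpa [plane, hopf] using le_ciSup hbdd x

lemma bddAbove_range_plane (hv : Monotone v) (hK : IsCompact K) (hF : ContinuousOn F K)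
    (hvK : ∀ x, v x ∈ K) (z : ℝ × ℝ) : BddAbove (range fun y => plane F v y z) := by
  obtain ⟨B, hB⟩ := hK.exists_bound_of_continuousOn hF
  refine ⟨primitive v z.1 + B * |z.2|, forall_mem_range.2 fun y => ?_⟩
  have hslope : F (v y) * z.2 ≤ B * |z.2| := (le_abs_self _).trans <| by
    rw [abs_mul]
    exact mul_le_mul_of_nonneg_right (hB _ (hvK y)) (abs_nonneg _)
  exact add_le_add (primitive_add_mul_le hv z.1 y) hslope

-- The slopes of planes that nearly attain the supremum at `z` stay in the compact set `K`, and a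
-- limit point of them is the slope of a supporting plane.
lemma exists_slope_hopf (hv : Monotone v) (hK : IsCompact K) (hF : ContinuousOn F K)
    (hvK : ∀ x, v x ∈ K) (z : ℝ × ℝ) : ∃ p ∈ K, ∀ w : ℝ × ℝ,
      hopf F v z + p * (w.1 - z.1) + F p * (w.2 - z.2) ≤ hopf F v w := by
  have hnear : ∀ k : ℕ, ∃ y, hopf F v z - 1 / ((k : ℝ) + 1) < plane F v y z := fun k =>
    exists_lt_of_lt_ciSup (sub_lt_self _ (by positivity))
  choose y hy using hnear
  obtain ⟨p, hp, φ, hφ, hlim⟩ := hK.tendsto_subseq (x := fun k => v (y k)) fun k => hvK _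
  have hFlim : Tendsto (fun k => F (v (y (φ k)))) atTop (𝓝 (F p)) :=
    (hF p hp).tendsto.comp (tendsto_nhdsWithin_iff.2 ⟨hlim, Eventually.of_forall fun k => hvK _⟩)
  have herr : Tendsto (fun k => 1 / ((φ k : ℝ) + 1)) atTop (𝓝 0) :=
    tendsto_one_div_add_atTop_nhds_zero_nat.comp hφ.tendsto_atTop
  refine ⟨p, hp, fun w => ?_⟩
  have hsum := (((tendsto_const_nhds (x := hopf F v z)).sub herr).add
    (hlim.mul_const (w.1 - z.1))).add (hFlim.mul_const (w.2 - z.2))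
  rw [sub_zero] at hsum
  refine le_of_tendsto' hsum fun k => ?_
  have hw : plane F v (y (φ k)) w ≤ hopf F v w :=
    le_ciSup (bddAbove_range_plane hv hK hF hvK w) (y (φ k))
  have hz := hy (φ k)
  simp only [plane, Function.comp_apply] at hw hz ⊢
  linarith

lemma exists_isSlopeField_hopf (hv : Monotone v) (hK : IsCompact K) (hF : ContinuousOn F K)
    (hvK : ∀ x, v x ∈ K) : ∃ n, IsSlopeField F (hopf F v) n ∧ ∀ z, n z ∈ K := by
  choose n hnK hn using exists_slope_hopf hv hK hF hvK
  exact ⟨n, hn, hnK⟩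

end Hopf

section Green

lemma hasDerivAt_fst_slice {ψ : ℝ × ℝ → ℝ} {x t : ℝ} (hψ : DifferentiableAt ℝ ψ (x, t)) :
    HasDerivAt (fun x => ψ (x, t)) (fderiv ℝ ψ (x, t) (1, 0)) x :=
  hψ.hasFDerivAt.comp_hasDerivAt x ((hasDerivAt_id x).prodMk (hasDerivAt_const x t))

lemma hasDerivAt_snd_slice {ψ : ℝ × ℝ → ℝ} {x t : ℝ} (hψ : DifferentiableAt ℝ ψ (x, t)) :
    HasDerivAt (fun t => ψ (x, t)) (fderiv ℝ ψ (x, t) (0, 1)) t :=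
  hψ.hasFDerivAt.comp_hasDerivAt t ((hasDerivAt_const t x).prodMk (hasDerivAt_id t))

lemma deriv_fst_slice {ψ : ℝ × ℝ → ℝ} (hψ : Differentiable ℝ ψ) (z : ℝ × ℝ) :
    deriv (fun x => ψ (x, z.2)) z.1 = fderiv ℝ ψ z (1, 0) :=
  (hasDerivAt_fst_slice (hψ z)).deriv

lemma deriv_snd_slice {ψ : ℝ × ℝ → ℝ} (hψ : Differentiable ℝ ψ) (z : ℝ × ℝ) :
    deriv (fun t => ψ (z.1, t)) z.2 = fderiv ℝ ψ z (0, 1) :=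
  (hasDerivAt_snd_slice (hψ z)).deriv

section Curl

variable {E : Type*} [NormedAddCommGroup E] [NormedSpace ℝ E] [FiniteDimensional ℝ E]
  [MeasurableSpace E] [BorelSpace E] {μ : Measure E} [μ.IsAddHaarMeasure]
  {C : NNReal} {f ψ : E → ℝ}

lemma integrable_lineDeriv_mul_fderiv (hf : LipschitzWith C f) (hψ : ContDiff ℝ 1 ψ)
    (hc : HasCompactSupport ψ) (e e' : E) :
    Integrable (fun z => lineDeriv ℝ f z e * fderiv ℝ ψ z e') μ :=
  (hf.locallyIntegrable_lineDeriv e).integrable_smul_right_of_hasCompactSupport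
    ((hψ.continuous_fderiv one_ne_zero).clm_apply continuous_const) (hc.fderiv_apply (𝕜 := ℝ) e')

lemma integral_lineDeriv_mul_fderiv_eq (hf : LipschitzWith C f) (hψ : ContDiff ℝ 2 ψ)
    (hc : HasCompactSupport ψ) (e e' : E) :
    ∫ z, lineDeriv ℝ f z e * fderiv ℝ ψ z e' ∂μ =
      ∫ z, -(fderiv ℝ (fderiv ℝ ψ) z e e') * f z ∂μ := by
  have hdψ : ContDiff ℝ 1 (fderiv ℝ ψ) := hψ.fderiv_right (by norm_num)
  have hs : ContDiff ℝ 1 fun z => fderiv ℝ ψ z e' := hdψ.clm_apply contDiff_const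
  have hcs : HasCompactSupport fun z => fderiv ℝ ψ z e' := hc.fderiv_apply (𝕜 := ℝ) e'
  obtain ⟨D, hD⟩ := hs.lipschitzWith_of_hasCompactSupport hcs one_ne_zero
  rw [hf.integral_lineDeriv_mul_eq (μ := μ) hD hcs]
  congr 1 with z
  rw [(hs.differentiable one_ne_zero z).lineDeriv_eq_fderiv, fderiv_clm_apply
    (hdψ.differentiable one_ne_zero z) (differentiableAt_const e')]
  simp

lemma integral_lineDeriv_mul_fderiv_comm (hf : LipschitzWith C f) (hψ : ContDiff ℝ 2 ψ)
    (hc : HasCompactSupport ψ) (e e' : E) :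
    ∫ z, lineDeriv ℝ f z e * fderiv ℝ ψ z e' ∂μ =
      ∫ z, lineDeriv ℝ f z e' * fderiv ℝ ψ z e ∂μ := by
  rw [integral_lineDeriv_mul_fderiv_eq (μ := μ) hf hψ hc,
    integral_lineDeriv_mul_fderiv_eq (μ := μ) hf hψ hc]
  congr 1 with z
  rw [(hψ.contDiffAt.isSymmSndFDerivAt (by simp)).eq e e']

end Curl

/-- The restriction of `U` to `t ≥ 0`, extended to `t < 0` by its values at `t = 0`. Crossing the
line `t = 0` its gradient jumps, which produces the boundary term in Green's formula. -/
def constantPast (U : ℝ × ℝ → ℝ) (z : ℝ × ℝ) : ℝ := U (z.1, max z.2 0)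

variable {U ψ : ℝ × ℝ → ℝ} {C : NNReal}

lemma exists_lipschitzWith_constantPast (hU : LipschitzWith C U) :
    ∃ C', LipschitzWith C' (constantPast U) :=
  ⟨_, hU.comp (LipschitzWith.prod_fst.prodMk (LipschitzWith.prod_snd.max_const 0))⟩

lemma lineDeriv_constantPast_of_pos {z : ℝ × ℝ} (hz : 0 < z.2) (e : ℝ × ℝ) :
    lineDeriv ℝ (constantPast U) z e = lineDeriv ℝ U z e := by
  refine EventuallyEq.lineDeriv_eq ?_
  filter_upwards [continuous_snd.continuousAt.eventually (lt_mem_nhds hz)] with w hw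
  simp only [constantPast, max_eq_left hw.le]

lemma lineDeriv_fst_constantPast_of_neg {z : ℝ × ℝ} (hz : z.2 < 0) :
    lineDeriv ℝ (constantPast U) z (1, 0) = deriv (fun x => U (x, 0)) z.1 := by
  simp [lineDeriv, constantPast, hz.le, deriv_comp_const_add (fun x => U (x, 0))]

lemma lineDeriv_snd_constantPast_of_neg {z : ℝ × ℝ} (hz : z.2 < 0) :
    lineDeriv ℝ (constantPast U) z (0, 1) = 0 := by
  have hconst : (fun s : ℝ => constantPast U (z + s • ((0, 1) : ℝ × ℝ))) =ᶠ[𝓝 0]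
      fun _ => U (z.1, 0) := by
    filter_upwards [gt_mem_nhds (neg_pos.2 hz)] with s hs
    have : z.2 + s ≤ 0 := by linarith
    simp [constantPast, this]
  rw [lineDeriv, hconst.deriv_eq, deriv_const]

lemma isClosedEmbedding_prodMk_right {X Y : Type*} [TopologicalSpace X] [TopologicalSpace Y]
    [T1Space X] (x : X) : IsClosedEmbedding (Prod.mk x : Y → X × Y) := by
  refine ⟨isEmbedding_prodMkRight x, ?_⟩
  have : range (Prod.mk x : Y → X × Y) = Prod.fst ⁻¹' {x} := by
    ext ⟨a, b⟩
    simp [eq_comm]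
  rw [this]
  exact isClosed_singleton.preimage continuous_fst

lemma integral_Iic_fderiv_snd (hψ : ContDiff ℝ 1 ψ) (hc : HasCompactSupport ψ) (x : ℝ) :
    ∫ t in Iic 0, fderiv ℝ ψ (x, t) (0, 1) = ψ (x, 0) := by
  have hslice : HasCompactSupport fun t => ψ (x, t) :=
    hc.comp_isClosedEmbedding (isClosedEmbedding_prodMk_right x)
  refine Eq.trans ?_ (hslice.integral_Iic_deriv_eq (hψ.comp (contDiff_prodMk_right x)) 0)
  congr 1 with t
  exact (deriv_snd_slice (hψ.differentiable one_ne_zero) (x, t)).symm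

lemma setIntegral_constantPast_of_nonpos (hU : LipschitzWith C U) (hψ : ContDiff ℝ 1 ψ)
    (hc : HasCompactSupport ψ) :
    ∫ z in univ ×ˢ Iic 0, (lineDeriv ℝ (constantPast U) z (1, 0) * fderiv ℝ ψ z (0, 1) -
        lineDeriv ℝ (constantPast U) z (0, 1) * fderiv ℝ ψ z (1, 0)) =
      ∫ x, deriv (fun x => U (x, 0)) x * ψ (x, 0) := by
  obtain ⟨C', hC'⟩ := exists_lipschitzWith_constantPast hU
  have hint := (integrable_lineDeriv_mul_fderiv (μ := volume) hC' hψ hc (1, 0) (0, 1)).sub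
    (integrable_lineDeriv_mul_fderiv hC' hψ hc (0, 1) (1, 0))
  rw [Measure.volume_eq_prod] at hint ⊢
  refine (setIntegral_prod _ hint.integrableOn).trans ?_
  rw [setIntegral_univ]
  congr 1 with x
  rw [← integral_Iic_fderiv_snd hψ hc x, ← integral_const_mul, integral_Iic_eq_integral_Iio,
    integral_Iic_eq_integral_Iio]
  refine setIntegral_congr_fun measurableSet_Iio fun t ht => ?_
  have hxt : (x, t).2 < 0 := ht
  simp only [Pi.sub_apply, lineDeriv_fst_constantPast_of_neg hxt,
    lineDeriv_snd_constantPast_of_neg hxt, zero_mul, sub_zero]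

lemma setIntegral_curl_eq_neg_integral_trace (hU : LipschitzWith C U) (hψ : ContDiff ℝ 2 ψ)
    (hc : HasCompactSupport ψ) :
    ∫ z in univ ×ˢ Ioi 0, (lineDeriv ℝ U z (1, 0) * fderiv ℝ ψ z (0, 1) -
        lineDeriv ℝ U z (0, 1) * fderiv ℝ ψ z (1, 0)) =
      -∫ x, deriv (fun x => U (x, 0)) x * ψ (x, 0) := by
  have hψ₁ : ContDiff ℝ 1 ψ := hψ.of_le (by norm_num)
  obtain ⟨C', hC'⟩ := exists_lipschitzWith_constantPast hU
  have hint := integrable_lineDeriv_mul_fderiv (μ := volume) hC' hψ₁ hc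
  have hupper : MeasurableSet (univ ×ˢ Ioi 0 : Set (ℝ × ℝ)) :=
    MeasurableSet.univ.prod measurableSet_Ioi
  have hcompl : (univ ×ˢ Ioi 0 : Set (ℝ × ℝ))ᶜ = univ ×ˢ Iic 0 := by ext; simp
  have hsplit := integral_add_compl hupper ((hint (1, 0) (0, 1)).sub (hint (0, 1) (1, 0)))
  simp only [Pi.sub_apply] at hsplit
  rw [integral_sub (hint _ _) (hint _ _), integral_lineDeriv_mul_fderiv_comm hC' hψ hc, sub_self,
    hcompl, setIntegral_constantPast_of_nonpos hU hψ₁ hc] at hsplit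
  rw [← eq_neg_of_add_eq_zero_left hsplit]
  refine setIntegral_congr_fun hupper fun z hz => ?_
  simp only [lineDeriv_constantPast_of_pos hz.2]

end Green

section Existence

lemma ae_deriv_primitive_eq {v : ℝ → ℝ} (hv : Monotone v) :
    ∀ᵐ x, deriv (primitive v) x = v x := by
  filter_upwards [LocallyIntegrable.ae_hasDerivAt_integral hv.locallyIntegrable] with x hx
    using (hx 0).deriv

theorem exists_monotone_weak_solution {F v : ℝ → ℝ} {K : Set ℝ} (hv : Monotone v)
    (hK : IsCompact K) (hF : ContinuousOn F K) (hvK : ∀ x, v x ∈ K) :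
    ∃ n : ℝ × ℝ → ℝ, AEStronglyMeasurable n ∧ (∀ z, n z ∈ K) ∧ (∀ t, Monotone fun x => n (x, t)) ∧
      ∀ ψ : ℝ × ℝ → ℝ, ContDiff ℝ 2 ψ → HasCompactSupport ψ →
        ∫ z in univ ×ˢ Ioi 0, (n z * fderiv ℝ ψ z (0, 1) - F (n z) * fderiv ℝ ψ z (1, 0)) =
          -∫ x, v x * ψ (x, 0) := by
  obtain ⟨n, hn, hnK⟩ := exists_isSlopeField_hopf hv hK hF hvK
  obtain ⟨C, hC⟩ := hn.exists_lipschitzWith hK hF hnK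
  refine ⟨n, hn.aestronglyMeasurable hC, hnK, hn.monotone_fst, fun ψ hψ hc => ?_⟩
  have htrace : ∫ x, deriv (fun x => hopf F v (x, 0)) x * ψ (x, 0) = ∫ x, v x * ψ (x, 0) := by
    simp only [hopf_zero hv]
    refine integral_congr_ae ?_
    filter_upwards [ae_deriv_primitive_eq hv] with x hx
    rw [hx]
  rw [← htrace, ← setIntegral_curl_eq_neg_integral_trace hC hψ hc]
  refine integral_congr_ae (ae_restrict_of_ae ?_)
  filter_upwards [hC.ae_differentiableAt] with z hz
  rw [(hn.lineDeriv_eq hz).1, (hn.lineDeriv_eq hz).2]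

lemma le_of_ae_restrict_Ioi_le {v : ℝ → ℝ} (hv : Monotone v) {a P : ℝ}
    (h : ∀ᵐ x ∂volume.restrict (Ioi a), v x ≤ P) (x : ℝ) : v x ≤ P := by
  have htail : ∀ᵐ y ∂volume.restrict (Ioi (max a x)), v y ≤ P :=
    ae_restrict_of_ae_restrict_of_subset (Ioi_subset_Ioi (le_max_left a x)) h
  have : (ae (volume.restrict (Ioi (max a x)))).NeBot := by
    rw [ae_neBot, ne_eq, Measure.restrict_eq_zero]
    simp
  obtain ⟨y, hyP, hxy⟩ := (htail.and (ae_restrict_mem measurableSet_Ioi)).exists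
  exact (hv ((le_max_right a x).trans hxy.le)).trans hyP

lemma monotone_indicator_Ioi {v : ℝ → ℝ} {a : ℝ} (h₀ : ∀ x, a < x → 0 ≤ v x)
    (hv : MonotoneOn v (Ioi a)) : Monotone (indicator (Ioi a) v) := by
  intro x y hxy
  by_cases hx : x ∈ Ioi a
  · have hy : y ∈ Ioi a := hx.trans_le hxy
    rw [indicator_of_mem hx, indicator_of_mem hy]
    exact hv hx hy hxy
  · rw [indicator_of_notMem hx]
    exact indicator_nonneg h₀ y

lemma measurableSet_quadrant : MeasurableSet quadrant := measurableSet_Ioi.prod measurableSet_Ioi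

lemma continuous_flux : Continuous flux :=
  continuous_const.mul (continuous_id.rpow_const fun _ => Or.inr (by norm_num))

lemma IsTestFunction.fderiv_eq_zero {ψ : ℝ × ℝ → ℝ} (hψ : IsTestFunction ψ) {z : ℝ × ℝ}
    (hz : z.1 ≤ 0) : fderiv ℝ ψ z = 0 := by
  by_contra h
  exact hz.not_gt (hψ.support_subset (support_fderiv_subset ℝ h)).1

lemma IsTestFunction.differentiable {ψ : ℝ × ℝ → ℝ} (hψ : IsTestFunction ψ) :
    Differentiable ℝ ψ :=
  hψ.smooth.differentiable (by simp)

theorem exists_isPositiveDensitySolution {m₀ : ℝ → ℝ}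
    (hm₀_bdd : MemLp m₀ ⊤ (volume.restrict (Ioi (0 : ℝ))))
    (hm₀_nonneg : ∀ x : ℝ, 0 < x → 0 ≤ m₀ x)
    (hm₀_mono : ∀ x h : ℝ, 0 < x → 0 < h → m₀ x ≤ m₀ (x + h)) :
    ∃ m, IsPositiveDensitySolution m₀ m := by
  set v : ℝ → ℝ := indicator (Ioi 0) m₀
  set P : ℝ := lpNorm m₀ ⊤ (volume.restrict (Ioi (0 : ℝ)))
  have hmonoOn : MonotoneOn m₀ (Ioi 0) := fun x hx y _ hxy => by
    rcases hxy.eq_or_lt with rfl | h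
    · exact le_rfl
    · simpa using hm₀_mono x (y - x) hx (sub_pos.2 h)
  have hv : Monotone v := monotone_indicator_Ioi hm₀_nonneg hmonoOn
  have hvP : ∀ x, v x ∈ Icc 0 P := fun x => by
    refine ⟨indicator_nonneg hm₀_nonneg x, le_of_ae_restrict_Ioi_le hv (a := 0) ?_ x⟩
    filter_upwards [ae_le_lpNorm_exponent_top hm₀_bdd, ae_restrict_mem measurableSet_Ioi]
      with y hy hy₀
    exact (indicator_of_mem hy₀ m₀).trans_le ((le_abs_self _).trans hy)
  obtain ⟨n, hn_meas, hnP, hn_mono, hn_weak⟩ :=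
    exists_monotone_weak_solution hv isCompact_Icc continuous_flux.neg.continuousOn hvP
  refine ⟨n, ⟨?_, fun z _ => (hnP z).1, fun ψ hψ => ?_⟩,
    fun x t h _ _ hh => hn_mono t (le_add_of_nonneg_right hh.le)⟩
  · refine memLp_top_of_bound hn_meas.restrict P (Eventually.of_forall fun z => ?_)
    rw [norm_of_nonneg (hnP z).1]
    exact (hnP z).2
  have hinit : ∫ x in Ioi (0 : ℝ), m₀ x * ψ (x, 0) = ∫ x, v x * ψ (x, 0) := by
    rw [← integral_indicator measurableSet_Ioi]
    simp only [v, indicator_mul_left]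
  rw [hinit, ← eq_neg_iff_add_eq_zero,
    ← hn_weak ψ (hψ.smooth.of_le (by norm_cast)) hψ.compactSupport]
  have hsub : quadrant ⊆ univ ×ˢ Ioi 0 := prod_mono_left (subset_univ _)
  simp only [deriv_fst_slice hψ.differentiable, deriv_snd_slice hψ.differentiable, Pi.neg_apply,
    neg_mul, sub_neg_eq_add]
  refine (setIntegral_eq_of_subset_of_forall_sdiff_eq_zero
    (MeasurableSet.univ.prod measurableSet_Ioi) hsub fun z hz => ?_).symm
  have hz₁ : z.1 ≤ 0 := not_lt.1 fun h => hz.2 ⟨h, hz.1.2⟩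
  simp [hψ.fderiv_eq_zero hz₁]

end Existence

section Monotone

variable {b u u' : ℝ → ℝ} {a c : ℝ}

lemma setIntegral_superlevel_deriv_nonpos (hb : Monotone b)
    (hu : ∀ x ∈ Icc a c, HasDerivAt u (u' x) x) (hu' : ContinuousOn u' (Icc a c))
    (hu₀ : ∀ x ∈ Icc a c, 0 ≤ u x) (huc : u c = 0) (s : ℝ) :
    ∫ x in Ioc a c ∩ {x | s < b x}, u' x ≤ 0 := by
  set S := Ioc a c ∩ {x | s < b x}
  rcases S.eq_empty_or_nonempty with hS | ⟨y, hy⟩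
  · simp [hS]
  have hbdd : BddBelow S := ⟨a, fun x hx => hx.1.1.le⟩
  have had : a ≤ sInf S := le_csInf ⟨y, hy⟩ fun x hx => hx.1.1.le
  have hdc : sInf S ≤ c := (csInf_le hbdd hy).trans hy.1.2
  have hlower : S ⊆ Icc (sInf S) c := fun x hx => ⟨csInf_le hbdd hx, hx.1.2⟩
  have hupper : Ioc (sInf S) c ⊆ S := fun x hx => by
    obtain ⟨w, hw, hwx⟩ := exists_lt_of_csInf_lt ⟨y, hy⟩ hx.1
    exact ⟨⟨had.trans_lt hx.1, hx.2⟩, hw.2.trans_le (hb hwx.le)⟩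
  have hS : S =ᵐ[volume] Ioc (sInf S) c :=
    (hlower.eventuallyLE.trans Ioc_ae_eq_Icc.symm.le).antisymm hupper.eventuallyLE
  have hsub : Icc (sInf S) c ⊆ Icc a c := Icc_subset_Icc_left had
  rw [setIntegral_congr_set hS, ← intervalIntegral.integral_of_le hdc,
    intervalIntegral.integral_eq_sub_of_hasDerivAt (f := u), huc, zero_sub, neg_nonpos]
  · exact hu₀ _ ⟨had, hdc⟩
  · rw [uIcc_of_le hdc]
    exact fun x hx => hu x (hsub hx)
  · exact (hu'.mono ((uIcc_of_le hdc).trans_subset hsub)).intervalIntegrable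

-- By the layer cake formula `b` is a superposition of indicators of superlevel sets, which
-- are intervals ending at `c`, where `u` vanishes.
lemma intervalIntegral_monotone_mul_deriv_nonpos (hac : a ≤ c) (hb : Monotone b)
    (hb₀ : ∀ x, 0 ≤ b x) (hu : ∀ x ∈ Icc a c, HasDerivAt u (u' x) x)
    (hu' : ContinuousOn u' (Icc a c)) (hu₀ : ∀ x ∈ Icc a c, 0 ≤ u x) (huc : u c = 0) :
    ∫ x in a..c, b x * u' x ≤ 0 := by
  have hint : IntegrableOn u' (Ioc a c) :=
    (hu'.integrableOn_compact isCompact_Icc).mono_set Ioc_subset_Icc_self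
  have hmeas : MeasurableSet {p : ℝ × ℝ | p.2 < b p.1} :=
    measurableSet_lt measurable_snd (hb.measurable.comp measurable_fst)
  have hlayer : ∀ x ∈ Ioc a c, b x * u' x =
      ∫ s in Ioc 0 (b c), {p : ℝ × ℝ | p.2 < b p.1}.indicator (fun p => u' p.1) (x, s) := by
    intro x hx
    have hslice : (fun s => {p : ℝ × ℝ | p.2 < b p.1}.indicator (fun p => u' p.1) (x, s)) =
        (Iio (b x)).indicator fun _ => u' x := rfl
    have hinter : Ioc 0 (b c) ∩ Iio (b x) = Ioo 0 (b x) :=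
      ext fun s => ⟨fun h => ⟨h.1.1, h.2⟩, fun h => ⟨⟨h.1, h.2.le.trans (hb hx.2)⟩, h.2⟩⟩
    rw [hslice, setIntegral_indicator measurableSet_Iio, hinter]
    simp [hb₀ x]
  rw [intervalIntegral.integral_of_le hac, setIntegral_congr_fun measurableSet_Ioc hlayer,
    integral_integral_swap (f := fun x s => {p : ℝ × ℝ | p.2 < b p.1}.indicator
      (fun p => u' p.1) (x, s)) ((Integrable.comp_fst hint _).indicator hmeas)]
  refine integral_nonpos fun s => ?_
  have hslice : (fun x => {p : ℝ × ℝ | p.2 < b p.1}.indicator (fun p => u' p.1) (x, s)) =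
      {x | s < b x}.indicator u' := rfl
  simp only [hslice, setIntegral_indicator (measurableSet_lt measurable_const hb.measurable)]
  exact setIntegral_superlevel_deriv_nonpos hb hu hu' hu₀ huc s

end Monotone

section Energy

variable {u b e : ℝ × ℝ → ℝ} {a c t₀ T : ℝ}

/-- `b` is a velocity field with values in `[0, L]` that is nondecreasing in `x`. -/
structure IsMonotoneSpeed (b : ℝ × ℝ → ℝ) (L : ℝ) : Prop where
  aestronglyMeasurable : AEStronglyMeasurable b
  mono : ∀ t, Monotone fun x => b (x, t)
  nonneg : ∀ z, 0 ≤ b z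
  le : ∀ z, b z ≤ L

namespace IsMonotoneSpeed

variable {L : ℝ}

lemma nonneg_bound (hb : IsMonotoneSpeed b L) : 0 ≤ L := (hb.nonneg 0).trans (hb.le 0)

lemma norm_le (hb : IsMonotoneSpeed b L) (z : ℝ × ℝ) : ‖b z‖ ≤ L :=
  (norm_of_nonneg (hb.nonneg z)).trans_le (hb.le z)

lemma integrableOn_mul (hb : IsMonotoneSpeed b L) {f : ℝ × ℝ → ℝ} {s : Set (ℝ × ℝ)}
    (hf : IntegrableOn f s) : IntegrableOn (fun z => b z * f z) s :=
  hf.bdd_mul hb.aestronglyMeasurable.restrict (Eventually.of_forall hb.norm_le)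

end IsMonotoneSpeed

lemma setIntegral_fderiv_snd_eq (hac : a ≤ c) (hT : t₀ ≤ T)
    (hu : ∀ z ∈ Icc a c ×ˢ Icc t₀ T, DifferentiableAt ℝ u z)
    (hu' : ContinuousOn (fderiv ℝ u) (Icc a c ×ˢ Icc t₀ T)) :
    ∫ z in Icc a c ×ˢ Icc t₀ T, fderiv ℝ u z (0, 1) = ∫ x in a..c, (u (x, T) - u (x, t₀)) := by
  have hcont : ContinuousOn (fun z => fderiv ℝ u z (0, 1)) (Icc a c ×ˢ Icc t₀ T) :=
    hu'.clm_apply continuousOn_const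
  rw [Measure.volume_eq_prod, setIntegral_prod _
    (hcont.integrableOn_compact (isCompact_Icc.prod isCompact_Icc)),
    intervalIntegral.integral_of_le hac, ← integral_Icc_eq_integral_Ioc]
  refine setIntegral_congr_fun measurableSet_Icc fun x hx => ?_
  simp only [integral_Icc_eq_integral_Ioc, ← intervalIntegral.integral_of_le hT]
  rw [← uIcc_of_le hT] at hu hcont
  exact intervalIntegral.integral_eq_sub_of_hasDerivAt
    (fun t ht => hasDerivAt_snd_slice (hu (x, t) ⟨hx, ht⟩))
    (hcont.comp (by fun_prop) fun t ht => ⟨hx, ht⟩).intervalIntegrable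

lemma setIntegral_monotone_mul_fderiv_fst_nonpos (hac : a ≤ c)
    (hb : ∀ t, Monotone fun x => b (x, t)) (hb₀ : ∀ z, 0 ≤ b z)
    (hu : ∀ z ∈ Icc a c ×ˢ Icc t₀ T, DifferentiableAt ℝ u z)
    (hu' : ContinuousOn (fderiv ℝ u) (Icc a c ×ˢ Icc t₀ T))
    (hu₀ : ∀ z ∈ Icc a c ×ˢ Icc t₀ T, 0 ≤ u z) (huc : ∀ t ∈ Icc t₀ T, u (c, t) = 0)
    (hint : IntegrableOn (fun z => b z * fderiv ℝ u z (1, 0)) (Icc a c ×ˢ Icc t₀ T)) :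
    ∫ z in Icc a c ×ˢ Icc t₀ T, b z * fderiv ℝ u z (1, 0) ≤ 0 := by
  rw [IntegrableOn, Measure.volume_eq_prod, ← Measure.prod_restrict] at hint
  rw [Measure.volume_eq_prod, ← Measure.prod_restrict, integral_prod_symm _ hint]
  refine setIntegral_nonpos measurableSet_Icc fun t ht => ?_
  rw [integral_Icc_eq_integral_Ioc, ← intervalIntegral.integral_of_le hac]
  exact intervalIntegral_monotone_mul_deriv_nonpos hac (hb t) (fun x => hb₀ (x, t))
    (fun x hx => hasDerivAt_fst_slice (hu (x, t) ⟨hx, ht⟩))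
    ((hu'.clm_apply continuousOn_const).comp (by fun_prop) fun x hx => ⟨hx, ht⟩)
    (fun x hx => hu₀ (x, t) ⟨hx, ht⟩) (huc t ht)

lemma intervalIntegral_le_of_fderiv_le {L : ℝ} (hac : a ≤ c) (hT : t₀ ≤ T)
    (hb : IsMonotoneSpeed b L)
    (hu : ∀ z ∈ Icc a c ×ˢ Icc t₀ T, DifferentiableAt ℝ u z)
    (hu' : ContinuousOn (fderiv ℝ u) (Icc a c ×ˢ Icc t₀ T))
    (hu₀ : ∀ z ∈ Icc a c ×ˢ Icc t₀ T, 0 ≤ u z) (huc : ∀ t ∈ Icc t₀ T, u (c, t) = 0)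
    (hut₀ : ∀ x ∈ Icc a c, u (x, t₀) = 0) (he : IntegrableOn e (Icc a c ×ˢ Icc t₀ T))
    (hle : ∀ z ∈ Icc a c ×ˢ Icc t₀ T,
      fderiv ℝ u z (0, 1) ≤ b z * fderiv ℝ u z (1, 0) + e z) :
    ∫ x in a..c, u (x, T) ≤ ∫ z in Icc a c ×ˢ Icc t₀ T, e z := by
  have hR : IsCompact (Icc a c ×ˢ Icc t₀ T) := isCompact_Icc.prod isCompact_Icc
  have hderiv : ∀ v, IntegrableOn (fun z => fderiv ℝ u z v) (Icc a c ×ˢ Icc t₀ T) := fun v =>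
    (hu'.clm_apply continuousOn_const).integrableOn_compact hR
  have hbx : IntegrableOn (fun z => b z * fderiv ℝ u z (1, 0)) (Icc a c ×ˢ Icc t₀ T) :=
    hb.integrableOn_mul (hderiv _)
  have htrace : ∫ x in a..c, u (x, T) = ∫ x in a..c, (u (x, T) - u (x, t₀)) := by
    refine intervalIntegral.integral_congr fun x hx => ?_
    rw [uIcc_of_le hac] at hx
    simp [hut₀ x hx]
  calc ∫ x in a..c, u (x, T) = ∫ z in Icc a c ×ˢ Icc t₀ T, fderiv ℝ u z (0, 1) :=
        htrace.trans (setIntegral_fderiv_snd_eq hac hT hu hu').symm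
    _ ≤ ∫ z in Icc a c ×ˢ Icc t₀ T, (b z * fderiv ℝ u z (1, 0) + e z) :=
        setIntegral_mono_on (hderiv _) (hbx.add he) hR.measurableSet hle
    _ = (∫ z in Icc a c ×ˢ Icc t₀ T, b z * fderiv ℝ u z (1, 0)) +
          ∫ z in Icc a c ×ˢ Icc t₀ T, e z := integral_add hbx he
    _ ≤ ∫ z in Icc a c ×ˢ Icc t₀ T, e z := add_le_of_nonpos_left
        (setIntegral_monotone_mul_fderiv_fst_nonpos hac hb.mono hb.nonneg hu hu' hu₀ huc hbx)

end Energy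

section Mollify

variable {E : Type*} [NormedAddCommGroup E] [NormedSpace ℝ E] [FiniteDimensional ℝ E]
  [MeasureSpace E] [BorelSpace E] [(volume : Measure E).IsAddHaarMeasure]
  {φ : ContDiffBump (0 : E)} {f : E → ℝ}

/-- The mollification of `f` by the bump function `φ`, normalised to have integral `1`. -/
noncomputable def mollify (φ : ContDiffBump (0 : E)) (f : E → ℝ) : E → ℝ :=
  convolution (φ.normed volume) f (ContinuousLinearMap.lsmul ℝ ℝ) volume

lemma contDiff_mollify (hf : LocallyIntegrable f) {n : ℕ∞} : ContDiff ℝ n (mollify φ f) :=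
  φ.hasCompactSupport_normed.contDiff_convolution_left _ φ.contDiff_normed hf

lemma continuous_mollify (hf : LocallyIntegrable f) : Continuous (mollify φ f) :=
  (contDiff_mollify (n := 0) hf).continuous

lemma abs_mollify_le (hf : AEStronglyMeasurable f) {A : ℝ} (hA : ∀ z, |f z| ≤ A) (z : E) :
    |mollify φ f z| ≤ A := by
  have := dist_convolution_le (x₀ := z) (z₀ := 0) ((abs_nonneg _).trans (hA z))
    φ.support_normed_eq.subset φ.nonneg_normed φ.integral_normed hf
    fun q _ => (dist_zero_right (f q)).trans_le (hA q)
  exact (dist_zero_right (mollify φ f z)).symm.trans_le this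

lemma mollify_eq_zero {z : E} (hf : ∀ q ∈ Metric.ball z φ.rOut, f q = 0) :
    mollify φ f z = 0 := by
  have hz : f z = 0 := hf z (Metric.mem_ball_self φ.rOut_pos)
  exact (φ.normed_convolution_eq_right fun q hq => (hf q hq).trans hz.symm).trans hz

lemma fderiv_mollify_apply (hf : LocallyIntegrable f) (z e : E) :
    fderiv ℝ (mollify φ f) z e =
      -∫ q, f q * fderiv ℝ (fun q => φ.normed volume (z - q)) q e := by
  have hφ : ContDiff ℝ 1 (φ.normed volume) := φ.contDiff_normed (n := 1)
  have hrefl : ∀ q, fderiv ℝ (fun q => φ.normed volume (z - q)) q e =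
      -fderiv ℝ (φ.normed volume) (z - q) e := fun q => by
    have := (hφ.differentiable one_ne_zero (z - q)).hasFDerivAt.comp q
      ((hasFDerivAt_id q).const_sub z)
    exact (DFunLike.congr_fun this.fderiv e).trans (by simp)
  have hflip : mollify φ f =
      convolution f (φ.normed volume) (ContinuousLinearMap.lsmul ℝ ℝ).flip volume :=
    (convolution_flip _).symm
  rw [hflip, (φ.hasCompactSupport_normed.hasFDerivAt_convolution_right _ hf hφ z).fderiv,
    convolution_precompR_apply _ hf (φ.hasCompactSupport_normed.fderiv ℝ)
      (hφ.continuous_fderiv one_ne_zero), ← integral_neg]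
  simp only [hrefl, mul_neg, neg_neg]
  exact integral_congr_ae (Eventually.of_forall fun q => mul_comm _ _)

end Mollify

section ApproximateIdentity

/-- A sequence of bump functions shrinking to the origin, used as an approximate identity. -/
noncomputable def shrinkingBump (E : Type*) [NormedAddCommGroup E] [NormedSpace ℝ E] (n : ℕ) :
    ContDiffBump (0 : E) where
  rIn := 1 / (n + 1) / 2
  rOut := 1 / (n + 1)
  rIn_pos := by positivity
  rIn_lt_rOut := half_lt_self (by positivity)

lemma tendsto_rOut_shrinkingBump {E : Type*} [NormedAddCommGroup E] [NormedSpace ℝ E] :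
    Tendsto (fun n => (shrinkingBump E n).rOut) atTop (𝓝 0) :=
  tendsto_one_div_add_atTop_nhds_zero_nat

lemma locallyIntegrable_of_abs_le {X : Type*} [TopologicalSpace X] [MeasurableSpace X]
    {μ : Measure X} [IsLocallyFiniteMeasure μ] {f : X → ℝ} {A : ℝ}
    (hf : AEStronglyMeasurable f μ) (hA : ∀ z, |f z| ≤ A) : LocallyIntegrable f μ :=
  (memLp_top_of_bound hf A (Eventually.of_forall hA)).locallyIntegrable le_top

variable {E : Type*} [NormedAddCommGroup E] [NormedSpace ℝ E] [FiniteDimensional ℝ E]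
  [MeasureSpace E] [BorelSpace E] [(volume : Measure E).IsAddHaarMeasure]
  {f g b : E → ℝ} {A : ℝ}

lemma ae_tendsto_mollify (hf : LocallyIntegrable f) :
    ∀ᵐ z, Tendsto (fun n => mollify (shrinkingBump E n) f z) atTop (𝓝 (f z)) :=
  ContDiffBump.ae_convolution_tendsto_right_of_locallyIntegrable (K := 2)
    tendsto_rOut_shrinkingBump
    (Eventually.of_forall fun _ => (mul_div_cancel₀ _ two_ne_zero).ge) hf

lemma tendsto_integral_mul_mollify (hf : AEStronglyMeasurable f) (hA : ∀ z, |f z| ≤ A)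
    (hg : Integrable g) :
    Tendsto (fun n => ∫ z, g z * mollify (shrinkingBump E n) f z) atTop
      (𝓝 (∫ z, g z * f z)) := by
  have hf' := locallyIntegrable_of_abs_le hf hA
  refine tendsto_integral_of_dominated_convergence (fun z => ‖g z‖ * A)
    (fun n => hg.aestronglyMeasurable.mul (continuous_mollify hf').aestronglyMeasurable)
    (hg.norm.mul_const A) (fun n => Eventually.of_forall fun z => ?_) ?_
  · rw [norm_mul]
    exact mul_le_mul_of_nonneg_left (abs_mollify_le hf hA z) (norm_nonneg _)
  · filter_upwards [ae_tendsto_mollify hf'] with z hz using hz.const_mul (g z)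

lemma tendsto_setIntegral_commutator {L : ℝ} (hb : AEStronglyMeasurable b) (hbL : ∀ z, ‖b z‖ ≤ L)
    (hf : AEStronglyMeasurable f) (hA : ∀ z, |f z| ≤ A) {s : Set E} (hs : volume s < ⊤) :
    Tendsto (fun n => ∫ z in s, |mollify (shrinkingBump E n) (b * f) z -
      b z * mollify (shrinkingBump E n) f z|) atTop (𝓝 0) := by
  have hbA : ∀ z, |(b * f) z| ≤ L * A := fun z => norm_mul_le_of_le (hbL z) (hA z)
  have hf' := locallyIntegrable_of_abs_le hf hA
  have hbf' := locallyIntegrable_of_abs_le (hb.mul hf) hbA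
  rw [← integral_zero E ℝ (μ := volume.restrict s)]
  refine tendsto_integral_of_dominated_convergence (fun _ => L * A + L * A) (fun n => ?_)
    (integrableOn_const hs.ne) (fun n => Eventually.of_forall fun z => ?_)
    (ae_restrict_of_ae ?_)
  · exact ((continuous_mollify hbf').aestronglyMeasurable.sub
      (hb.mul (continuous_mollify hf').aestronglyMeasurable)).norm.restrict
  · rw [norm_eq_abs, abs_abs]
    refine (abs_sub _ _).trans (add_le_add (abs_mollify_le (hb.mul hf) hbA z) ?_)
    exact norm_mul_le_of_le (hbL z) (abs_mollify_le hf hA z)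
  · filter_upwards [ae_tendsto_mollify hf', ae_tendsto_mollify hbf'] with z hz hbz
    have := (hbz.sub (hz.const_mul (b z))).abs
    rwa [Pi.mul_apply, sub_self, abs_zero] at this

end ApproximateIdentity

lemma sq_integral_mul_le_integral_sq_mul {α : Type*} [MeasurableSpace α] {μ : Measure α}
    {f g : α → ℝ} (hf : MemLp f 2 μ) (hg : MemLp g 2 μ) :
    (∫ x, f x * g x ∂μ) ^ 2 ≤ (∫ x, f x ^ 2 ∂μ) * ∫ x, g x ^ 2 ∂μ := by
  have inner_eq : ∀ {u v : α → ℝ} (hu : MemLp u 2 μ) (hv : MemLp v 2 μ),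
      inner ℝ (hu.toLp u) (hv.toLp v) = ∫ x, u x * v x ∂μ := fun hu hv => by
    rw [L2.inner_def]
    refine integral_congr_ae ?_
    filter_upwards [hu.coeFn_toLp, hv.coeFn_toLp] with x hux hvx
    rw [hux, hvx]
    exact mul_comm _ _
  have := real_inner_mul_inner_self_le (hf.toLp f) (hg.toLp g)
  rw [inner_eq hf hg, inner_eq hf hf, inner_eq hg hg] at this
  simpa only [sq] using this

section Potential

open ContinuousLinearMap (fst snd)

/-- `W` is a potential of the one-form `D dx + G dt` on the half-plane `x > r`, normalised to vanish
at time `t₀`. -/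
structure IsPotential (W D G : ℝ × ℝ → ℝ) (r t₀ : ℝ) : Prop where
  hasFDerivAt : ∀ z : ℝ × ℝ, r < z.1 → HasFDerivAt W (D z • fst ℝ ℝ ℝ + G z • snd ℝ ℝ ℝ) z
  initial : ∀ x, r < x → W (x, t₀) = 0

lemma clm_apply_eq_add (A : ℝ × ℝ →L[ℝ] ℝ) (v : ℝ × ℝ) :
    A v = v.1 * A (1, 0) + v.2 * A (0, 1) := by
  rw [← smul_eq_mul, ← smul_eq_mul, ← map_smul, ← map_smul, ← map_add]
  simp

lemma exists_isPotential {D G : ℝ × ℝ → ℝ} {r t₀ : ℝ} (hD : Differentiable ℝ D)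
    (hG : Differentiable ℝ G)
    (hcurl : ∀ z : ℝ × ℝ, r < z.1 → fderiv ℝ D z (0, 1) = fderiv ℝ G z (1, 0))
    (hD₀ : ∀ x, D (x, t₀) = 0) : ∃ W, IsPotential W D G r t₀ := by
  set θ : ℝ × ℝ → ℝ × ℝ →L[ℝ] ℝ := fun z =>
    D z • fst ℝ ℝ ℝ + G z • snd ℝ ℝ ℝ
  have hθ : ∀ z, HasFDerivAt θ ((fderiv ℝ D z).smulRight (fst ℝ ℝ ℝ) +
      (fderiv ℝ G z).smulRight (snd ℝ ℝ ℝ)) z := fun z =>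
    ((hD z).hasFDerivAt.smul_const (fst ℝ ℝ ℝ)).add ((hG z).hasFDerivAt.smul_const (snd ℝ ℝ ℝ))
  have hhalf : Convex ℝ {z : ℝ × ℝ | r < z.1} :=
    convex_halfSpace_gt (LinearMap.fst ℝ ℝ ℝ).isLinear r
  obtain ⟨f, hf⟩ := hhalf.exists_forall_hasFDerivAt_of_fderiv_symmetric
    (isOpen_lt continuous_const continuous_fst)
    (fun z _ => (hθ z).differentiableAt.differentiableWithinAt) fun z hz x y => by
      simp only [(hθ z).fderiv, add_apply, ContinuousLinearMap.smulRight_apply,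
        smul_apply, ContinuousLinearMap.coe_fst', ContinuousLinearMap.coe_snd',
        smul_eq_mul]
      rw [clm_apply_eq_add _ x, clm_apply_eq_add _ y, clm_apply_eq_add (fderiv ℝ G z) x,
        clm_apply_eq_add (fderiv ℝ G z) y, hcurl z hz]
      ring
  have hconst : ∀ x, r < x → f (x, t₀) = f (r + 1, t₀) := fun x hx => by
    have hderiv : ∀ y ∈ Ioi r, HasDerivAt (fun y => f (y, t₀)) 0 y := fun y hy =>
      (hasDerivAt_fst_slice (hf (y, t₀) hy).differentiableAt).congr_deriv (by
        simp [(hf (y, t₀) hy).fderiv, θ, hD₀])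
    have := (convex_Ioi r).norm_image_sub_le_of_norm_hasDerivWithin_le
      (fun y hy => (hderiv y hy).hasDerivWithinAt) (fun _ _ => norm_zero.le)
      (mem_Ioi.2 (lt_add_one r)) (mem_Ioi.2 hx)
    rwa [zero_mul, norm_le_zero_iff, sub_eq_zero] at this
  refine ⟨fun z => f z - f (r + 1, t₀), fun z hz => (hf z hz).sub_const _, fun x hx => ?_⟩
  rw [hconst x hx, sub_self]

lemma IsPotential.abs_le {W D G : ℝ × ℝ → ℝ} {r t₀ A : ℝ} (hW : IsPotential W D G r t₀)
    (hG : ∀ z, |G z| ≤ A) {z : ℝ × ℝ} (hz : r < z.1) : |W z| ≤ A * |z.2 - t₀| := by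
  have hderiv : ∀ t, HasDerivAt (fun t => W (z.1, t)) (G (z.1, t)) t := fun t => by
    have := hW.hasFDerivAt (z.1, t) hz
    exact (hasDerivAt_snd_slice this.differentiableAt).congr_deriv (by simp [this.fderiv])
  have := convex_univ.norm_image_sub_le_of_norm_hasDerivWithin_le
    (fun t _ => (hderiv t).hasDerivWithinAt) (fun t _ => hG (z.1, t)) (mem_univ t₀) (mem_univ z.2)
  rwa [hW.initial _ hz, sub_zero] at this

lemma hasDerivAt_smoothTransition (x : ℝ) :
    HasDerivAt smoothTransition (deriv smoothTransition x) x :=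
  ((smoothTransition.contDiff (n := 1)).differentiable one_ne_zero x).hasDerivAt

lemma IsMonotoneSpeed.integrableOn_abs_sub_mul {b D G : ℝ × ℝ → ℝ} {L : ℝ}
    (hb : IsMonotoneSpeed b L) (hD : Continuous D) (hG : Continuous G) {s : Set (ℝ × ℝ)}
    (hs : IsCompact s) : IntegrableOn (fun z => |G z - b z * D z|) s :=
  ((hG.continuousOn.integrableOn_compact hs).sub
    (hb.integrableOn_mul (hD.continuousOn.integrableOn_compact hs))).abs

/-- The square of `W`, cut off smoothly outside the backward cone `x ≤ c - L (t - t₀)`, which is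
the domain of dependence for transport with speeds in `[0, L]`. -/
noncomputable def coneEnergy (W : ℝ × ℝ → ℝ) (c L t₀ : ℝ) (z : ℝ × ℝ) : ℝ :=
  smoothTransition (c - z.1 - L * (z.2 - t₀)) * W z ^ 2

lemma coneEnergy_nonneg (W : ℝ × ℝ → ℝ) (c L t₀ : ℝ) (z : ℝ × ℝ) : 0 ≤ coneEnergy W c L t₀ z :=
  mul_nonneg (smoothTransition.nonneg _) (sq_nonneg _)

namespace IsPotential

variable {W D G b : ℝ × ℝ → ℝ} {r t₀ A c L : ℝ}

lemma continuousOn (hW : IsPotential W D G r t₀) : ContinuousOn W {z | r < z.1} := fun z hz =>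
  (hW.hasFDerivAt z hz).continuousAt.continuousWithinAt

lemma hasFDerivAt_coneEnergy (hW : IsPotential W D G r t₀) (c L : ℝ) {z : ℝ × ℝ}
    (hz : r < z.1) :
    HasFDerivAt (coneEnergy W c L t₀)
      (smoothTransition (c - z.1 - L * (z.2 - t₀)) •
          ((2 * W z) • (D z • fst ℝ ℝ ℝ + G z • snd ℝ ℝ ℝ)) -
        (W z ^ 2 * deriv smoothTransition (c - z.1 - L * (z.2 - t₀))) •
          (fst ℝ ℝ ℝ + L • snd ℝ ℝ ℝ)) z := by
  have hphase : HasFDerivAt (fun z : ℝ × ℝ => c - z.1 - L * (z.2 - t₀))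
      (-(fst ℝ ℝ ℝ) - L • snd ℝ ℝ ℝ) z :=
    (hasFDerivAt_fst.const_sub c).sub ((hasFDerivAt_snd.sub_const t₀).const_mul L)
  refine (((hasDerivAt_smoothTransition _).comp_hasFDerivAt z hphase).mul
    ((hW.hasFDerivAt z hz).pow 2)).congr_fderiv ?_
  ext <;> simp <;> ring

lemma continuousOn_fderiv_coneEnergy (hW : IsPotential W D G r t₀) (hD : Continuous D)
    (hG : Continuous G) (c L : ℝ) :
    ContinuousOn (fderiv ℝ (coneEnergy W c L t₀)) {z | r < z.1} := by
  have hWc := hW.continuousOn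
  have : Continuous (deriv smoothTransition) :=
    (smoothTransition.contDiff (n := 1)).continuous_deriv le_rfl
  have : Continuous smoothTransition := smoothTransition.continuous
  refine ContinuousOn.congr ?_ fun z hz => (hW.hasFDerivAt_coneEnergy c L hz).fderiv
  fun_prop

-- With `η` the cutoff profile, the term `(b - L) η' W²` coming from its derivative has the
-- favourable sign since `b ≤ L` and `0 ≤ η'`.
lemma fderiv_coneEnergy_le (hW : IsPotential W D G r t₀) {K : ℝ} {z : ℝ × ℝ} (hz : r < z.1)
    (hWK : |W z| ≤ K) (hbL : b z ≤ L) :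
    fderiv ℝ (coneEnergy W c L t₀) z (0, 1) ≤
      b z * fderiv ℝ (coneEnergy W c L t₀) z (1, 0) + 2 * K * |G z - b z * D z| := by
  rw [(hW.hasFDerivAt_coneEnergy c L hz).fderiv]
  set s := c - z.1 - L * (z.2 - t₀)
  have hcut : 0 ≤ (L - b z) * (W z ^ 2 * deriv smoothTransition s) :=
    mul_nonneg (sub_nonneg.2 hbL)
      (mul_nonneg (sq_nonneg _) smoothTransition.monotone.deriv_nonneg)
  have herr : smoothTransition s * (W z * (G z - b z * D z)) ≤ K * |G z - b z * D z| :=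
    calc smoothTransition s * (W z * (G z - b z * D z))
        ≤ smoothTransition s * (|W z| * |G z - b z * D z|) := by
          rw [← abs_mul]
          exact mul_le_mul_of_nonneg_left (le_abs_self _) (smoothTransition.nonneg _)
      _ ≤ 1 * (K * |G z - b z * D z|) := by
          gcongr
          exact smoothTransition.le_one _
      _ = K * |G z - b z * D z| := one_mul _
  simp only [sub_apply, add_apply, smul_apply, ContinuousLinearMap.coe_fst',
    ContinuousLinearMap.coe_snd', smul_eq_mul]
  linarith

lemma intervalIntegral_coneEnergy_le (hW : IsPotential W D G r t₀) (hD : Continuous D)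
    (hG : Continuous G) (hGA : ∀ z, |G z| ≤ A) (hb : IsMonotoneSpeed b L)
    {a t T : ℝ} (hra : r < a) (hac : a ≤ c) (ht : t ∈ Icc t₀ T) :
    ∫ x in a..c, coneEnergy W c L t₀ (x, t) ≤
      2 * (A * (T - t₀)) * ∫ z in Icc a c ×ˢ Icc t₀ T, |G z - b z * D z| := by
  have hhalf : ∀ s, Icc a c ×ˢ Icc t₀ s ⊆ {z : ℝ × ℝ | r < z.1} :=
    fun s z hz => hra.trans_le hz.1.1
  have hA : 0 ≤ A := (abs_nonneg _).trans (hGA 0)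
  have hL : 0 ≤ L := hb.nonneg_bound
  have hWK : ∀ z ∈ Icc a c ×ˢ Icc t₀ t, |W z| ≤ A * (T - t₀) := fun z hz => by
    refine (hW.abs_le hGA (hhalf t hz)).trans (mul_le_mul_of_nonneg_left ?_ hA)
    rw [abs_of_nonneg (sub_nonneg.2 hz.2.1)]
    exact sub_le_sub_right (hz.2.2.trans ht.2) t₀
  have hdefect := hb.integrableOn_abs_sub_mul hD hG
    (isCompact_Icc.prod isCompact_Icc : IsCompact (Icc a c ×ˢ Icc t₀ T))
  have hsub : Icc a c ×ˢ Icc t₀ t ⊆ Icc a c ×ˢ Icc t₀ T :=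
    prod_mono_right (Icc_subset_Icc_right ht.2)
  refine (intervalIntegral_le_of_fderiv_le hac ht.1 hb
    (fun z hz => (hW.hasFDerivAt_coneEnergy c L (hhalf t hz)).differentiableAt)
    ((hW.continuousOn_fderiv_coneEnergy hD hG c L).mono (hhalf t))
    (fun z _ => coneEnergy_nonneg W c L t₀ z) ?_ ?_ ((hdefect.mono_set hsub).const_mul _)
    fun z hz => hW.fderiv_coneEnergy_le (hhalf t hz) (hWK z hz) (hb.le z)).trans ?_
  · intro s hs
    have : c - c - L * (s - t₀) ≤ 0 := by linarith [mul_nonneg hL (sub_nonneg.2 hs.1)]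
    rw [coneEnergy, smoothTransition.zero_of_nonpos this, zero_mul]
  · exact fun x hx => by simp [coneEnergy, hW.initial x (hra.trans_le hx.1)]
  · rw [integral_const_mul]
    have hT : 0 ≤ T - t₀ := sub_nonneg.2 (ht.1.trans ht.2)
    exact mul_le_mul_of_nonneg_left (setIntegral_mono_set hdefect
      (Eventually.of_forall fun z => abs_nonneg _) hsub.eventuallyLE) (by positivity)

lemma setIntegral_slice_sq_le (hW : IsPotential W D G r t₀) (hD : Continuous D)
    (hG : Continuous G) (hGA : ∀ z, |G z| ≤ A) (hb : IsMonotoneSpeed b L)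
    {a x₀ t T : ℝ} (hra : r < a) (hax : a ≤ x₀) (ht : t ∈ Icc t₀ T)
    (hc : x₀ + 1 + L * (T - t₀) ≤ c) :
    ∫ x in Icc a x₀, W (x, t) ^ 2 ≤
      2 * (A * (T - t₀)) * ∫ z in Icc a c ×ˢ Icc t₀ T, |G z - b z * D z| := by
  have hL : 0 ≤ L := hb.nonneg_bound
  have hLt : L * (t - t₀) ≤ L * (T - t₀) := mul_le_mul_of_nonneg_left (sub_le_sub_right ht.2 t₀) hL
  have hxc : x₀ ≤ c := by linarith [mul_nonneg hL (sub_nonneg.2 ht.1)]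
  have hone : ∀ x ∈ Icc a x₀, W (x, t) ^ 2 = coneEnergy W c L t₀ (x, t) := fun x hx => by
    have : 1 ≤ c - x - L * (t - t₀) := by linarith [hx.2]
    rw [coneEnergy, smoothTransition.one_of_one_le this, one_mul]
  have hint : IntegrableOn (fun x => coneEnergy W c L t₀ (x, t)) (Icc a c) :=
    ContinuousOn.integrableOn_compact isCompact_Icc fun x hx =>
      (hasDerivAt_fst_slice (hW.hasFDerivAt_coneEnergy c L
        (hra.trans_le hx.1)).differentiableAt).continuousAt.continuousWithinAt
  calc ∫ x in Icc a x₀, W (x, t) ^ 2 = ∫ x in Icc a x₀, coneEnergy W c L t₀ (x, t) :=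
        setIntegral_congr_fun measurableSet_Icc hone
    _ ≤ ∫ x in Icc a c, coneEnergy W c L t₀ (x, t) :=
        setIntegral_mono_set hint (Eventually.of_forall fun x => coneEnergy_nonneg W c L t₀ _)
          (Icc_subset_Icc_right hxc).eventuallyLE
    _ = ∫ x in a..c, coneEnergy W c L t₀ (x, t) := by
        rw [integral_Icc_eq_integral_Ioc, intervalIntegral.integral_of_le (hax.trans hxc)]
    _ ≤ _ := hW.intervalIntegral_coneEnergy_le hD hG hGA hb hra (hax.trans hxc) ht

lemma setIntegral_sq_le (hW : IsPotential W D G r t₀) (hD : Continuous D)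
    (hG : Continuous G) (hGA : ∀ z, |G z| ≤ A) (hb : IsMonotoneSpeed b L)
    {a x₀ T : ℝ} (hra : r < a) (hax : a ≤ x₀) (hT : t₀ ≤ T)
    (hc : x₀ + 1 + L * (T - t₀) ≤ c) :
    ∫ z in Icc a x₀ ×ˢ Icc t₀ T, W z ^ 2 ≤ 2 * (A * (T - t₀)) *
      (∫ z in Icc a c ×ˢ Icc t₀ T, |G z - b z * D z|) * (T - t₀) := by
  have hint : IntegrableOn (fun z => W z ^ 2) (Icc a x₀ ×ˢ Icc t₀ T) :=
    ((hW.continuousOn.mono fun z hz => hra.trans_le hz.1.1).pow 2).integrableOn_compact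
      (isCompact_Icc.prod isCompact_Icc)
  rw [IntegrableOn, Measure.volume_eq_prod, ← Measure.prod_restrict] at hint
  have hfubini : ∫ z in Icc a x₀ ×ˢ Icc t₀ T, W z ^ 2 =
      ∫ t in Icc t₀ T, ∫ x in Icc a x₀, W (x, t) ^ 2 := by
    rw [Measure.volume_eq_prod, ← Measure.prod_restrict, integral_prod_symm _ hint]
  refine hfubini.trans_le ((Real.le_norm_self _).trans ((norm_setIntegral_le_of_norm_le_const
    measure_Icc_lt_top fun t ht => ?_).trans_eq (by rw [Real.volume_real_Icc_of_le hT])))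
  rw [norm_of_nonneg (integral_nonneg fun x => sq_nonneg _)]
  exact hW.setIntegral_slice_sq_le hD hG hGA hb hra hax ht hc

lemma integral_mul_eq_neg (hW : IsPotential W D G r t₀) (hD : Continuous D) {φ : ℝ × ℝ → ℝ}
    (hφ : ContDiff ℝ 1 φ) (hφc : HasCompactSupport φ) (hφr : tsupport φ ⊆ {z | r < z.1}) :
    ∫ z, φ z * D z = -∫ z, fderiv ℝ φ z (1, 0) * W z := by
  have hφ' : Continuous fun z => fderiv ℝ φ z (1, 0) :=
    (hφ.continuous_fderiv one_ne_zero).clm_apply continuous_const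
  have hmul : ∀ z, φ z * fderiv ℝ W z (1, 0) = φ z * D z := fun z => by
    by_cases hz : z ∈ tsupport φ
    · simp [(hW.hasFDerivAt z (hφr hz)).fderiv]
    · simp [image_eq_zero_of_notMem_tsupport hz]
  have hWφ := hW.continuousOn.mono hφr
  simp only [← hmul]
  refine integral_mul_fderiv_eq_neg_fderiv_mul_of_integrable ?_ ?_ ?_
    (fun z _ => hφ.differentiable one_ne_zero z)
    (fun z hz => (hW.hasFDerivAt z (hφr hz)).differentiableAt)
  · refine ((hφ'.continuousOn.mul hWφ).integrableOn_compact hφc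
      ).integrable_of_forall_notMem_eq_zero fun z hz => ?_
    simp [fderiv_of_notMem_tsupport (𝕜 := ℝ) hz]
  · simp only [hmul]
    exact (hφ.continuous.mul hD).integrable_of_hasCompactSupport hφc.mul_right
  · refine ((hφ.continuous.continuousOn.mul hWφ).integrableOn_compact hφc
      ).integrable_of_forall_notMem_eq_zero fun z hz => ?_
    simp [image_eq_zero_of_notMem_tsupport hz]

lemma sq_integral_mul_le (hW : IsPotential W D G r t₀) (hD : Continuous D) {φ : ℝ × ℝ → ℝ}
    (hφ : ContDiff ℝ 1 φ) {s : Set (ℝ × ℝ)} (hs : IsCompact s) (hsr : s ⊆ {z | r < z.1})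
    (hφs : tsupport φ ⊆ s) :
    (∫ z, φ z * D z) ^ 2 ≤ (∫ z in s, fderiv ℝ φ z (1, 0) ^ 2) * ∫ z in s, W z ^ 2 := by
  have hφc : HasCompactSupport φ := hs.of_isClosed_subset (isClosed_tsupport φ) hφs
  have hφ' : Continuous fun z => fderiv ℝ φ z (1, 0) :=
    (hφ.continuous_fderiv one_ne_zero).clm_apply continuous_const
  have hlocal : ∫ z in s, fderiv ℝ φ z (1, 0) * W z = ∫ z, fderiv ℝ φ z (1, 0) * W z :=
    setIntegral_eq_integral_of_forall_compl_eq_zero fun z hz => by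
      simp [fderiv_of_notMem_tsupport (𝕜 := ℝ) (mt (@hφs z) hz)]
  have memLp : ∀ {f : ℝ × ℝ → ℝ}, ContinuousOn f s → MemLp f 2 (volume.restrict s) := fun hf =>
    (memLp_two_iff_integrable_sq (hf.aestronglyMeasurable hs.measurableSet)).2
      ((hf.pow 2).integrableOn_compact hs)
  rw [hW.integral_mul_eq_neg hD hφ hφc (hφs.trans hsr), ← hlocal, neg_sq]
  exact sq_integral_mul_le_integral_sq_mul (memLp hφ'.continuousOn)
    (memLp (hW.continuousOn.mono hsr))

end IsPotential

end Potential

section Transport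

lemma exists_box_of_isCompact {K : Set (ℝ × ℝ)} (hK : IsCompact K) (hq : K ⊆ quadrant) :
    ∃ a r : ℝ, 0 < a ∧ a ≤ r ∧ K ⊆ Icc a r ×ˢ Icc 0 r := by
  rcases K.eq_empty_or_nonempty with rfl | hne
  · exact ⟨1, 1, one_pos, le_rfl, empty_subset _⟩
  obtain ⟨z, hz, hmin⟩ := hK.exists_isMinOn hne continuous_fst.continuousOn
  obtain ⟨r, hr⟩ := hK.isBounded.subset_closedBall 0
  have hle : ∀ q ∈ K, q.1 ≤ r ∧ q.2 ≤ r := fun q hqK => by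
    have hnorm : ‖q‖ ≤ r := mem_closedBall_zero_iff.1 (hr hqK)
    exact ⟨(le_abs_self _).trans ((norm_fst_le q).trans hnorm),
      (le_abs_self _).trans ((norm_snd_le q).trans hnorm)⟩
  exact ⟨z.1, r, (hq hz).1, (hle z hz).1, fun q hqK =>
    ⟨⟨hmin hqK, (hle q hqK).1⟩, ⟨(hq hqK).2.le, (hle q hqK).2⟩⟩⟩

lemma isTestFunction_reflected_bump {φ : ContDiffBump (0 : ℝ × ℝ)} {z : ℝ × ℝ}
    (hz : φ.rOut < z.1) : IsTestFunction fun q => φ.normed volume (z - q) where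
  smooth := φ.contDiff_normed.comp (contDiff_const.sub contDiff_id)
  compactSupport := φ.hasCompactSupport_normed.comp_homeomorph (Homeomorph.subLeft z)
  support_subset := by
    have hsupp : tsupport (fun q => φ.normed volume (z - q)) ⊆ Metric.closedBall z φ.rOut := by
      refine closure_minimal (fun q hq => ?_) Metric.isClosed_closedBall
      have : z - q ∈ Metric.ball 0 φ.rOut := φ.support_normed_eq.subset hq
      rw [Metric.mem_closedBall', dist_eq_norm]
      exact (mem_ball_zero_iff.1 this).le
    intro q hq
    have hq₁ := (norm_fst_le (z - q)).trans (mem_closedBall_iff_norm'.1 (hsupp hq))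
    have hle := (le_abs_self (z.1 - q.1)).trans hq₁
    exact ⟨by rw [mem_Ioi]; linarith, mem_univ _⟩

/-- `δ` is a weak solution of `δ_t = (b δ)_x` on `x > 0` with zero initial values, extended by
zero to negative times. -/
structure IsTransportSolution (b δ : ℝ × ℝ → ℝ) : Prop where
  eq_zero : ∀ z : ℝ × ℝ, z.2 ≤ 0 → δ z = 0
  weak_eq : ∀ ψ, IsTestFunction ψ →
    ∫ q, δ q * fderiv ℝ ψ q (0, 1) = ∫ q, (b * δ) q * fderiv ℝ ψ q (1, 0)

namespace IsTransportSolution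

variable {b δ : ℝ × ℝ → ℝ} {A L : ℝ}

lemma fderiv_mollify_eq (h : IsTransportSolution b δ) (hδ : LocallyIntegrable δ)
    (hbδ : LocallyIntegrable (b * δ)) {φ : ContDiffBump (0 : ℝ × ℝ)} {z : ℝ × ℝ}
    (hz : φ.rOut < z.1) :
    fderiv ℝ (mollify φ δ) z (0, 1) = fderiv ℝ (mollify φ (b * δ)) z (1, 0) := by
  rw [fderiv_mollify_apply hδ, fderiv_mollify_apply hbδ,
    h.weak_eq _ (isTestFunction_reflected_bump hz)]

lemma exists_isPotential_mollify (h : IsTransportSolution b δ) (hδ : LocallyIntegrable δ)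
    (hbδ : LocallyIntegrable (b * δ)) {φ : ContDiffBump (0 : ℝ × ℝ)}
    (hφ : φ.rOut ≤ 1) :
    ∃ W, IsPotential W (mollify φ δ) (mollify φ (b * δ)) φ.rOut (-1) := by
  refine exists_isPotential ((contDiff_mollify (n := 1) hδ).differentiable one_ne_zero)
    ((contDiff_mollify (n := 1) hbδ).differentiable one_ne_zero)
    (fun z hz => h.fderiv_mollify_eq hδ hbδ hz)
    fun x => mollify_eq_zero fun q hq => h.eq_zero q ?_
  have hq₂ := (norm_snd_le (q - (x, -1))).trans_lt (mem_ball_iff_norm.1 hq)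
  have hle := (le_abs_self (q.2 - -1)).trans_lt hq₂
  linarith

lemma sq_integral_mul_mollify_le (h : IsTransportSolution b δ) (hb : IsMonotoneSpeed b L)
    (hδ : AEStronglyMeasurable δ) (hδA : ∀ z, |δ z| ≤ A) {a r : ℝ} (har : a ≤ r) (hr : -1 ≤ r)
    {ψ : ℝ × ℝ → ℝ} (hψ : ContDiff ℝ 1 ψ) (hψS : tsupport ψ ⊆ Icc a r ×ˢ Icc (-1) r)
    {φ : ContDiffBump (0 : ℝ × ℝ)} (hφa : φ.rOut < a) (hφ₁ : φ.rOut ≤ 1) :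
    (∫ z, ψ z * mollify φ δ z) ^ 2 ≤ (∫ z in Icc a r ×ˢ Icc (-1) r, fderiv ℝ ψ z (1, 0) ^ 2) *
      (2 * (L * A * (r - -1)) * (∫ z in Icc a (r + 1 + L * (r - -1)) ×ˢ Icc (-1) r,
        |mollify φ (b * δ) z - b z * mollify φ δ z|) * (r - -1)) := by
  have hbδA : ∀ z, |(b * δ) z| ≤ L * A := fun z => norm_mul_le_of_le (hb.norm_le z) (hδA z)
  have hbδ := hb.aestronglyMeasurable.mul hδ
  have hδ' := locallyIntegrable_of_abs_le hδ hδA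
  have hbδ' := locallyIntegrable_of_abs_le hbδ hbδA
  obtain ⟨W, hW⟩ := h.exists_isPotential_mollify hδ' hbδ' hφ₁
  refine (hW.sq_integral_mul_le (continuous_mollify hδ') hψ (isCompact_Icc.prod isCompact_Icc)
    (fun z hz => hφa.trans_le hz.1.1) hψS).trans (mul_le_mul_of_nonneg_left ?_
      (integral_nonneg fun z => sq_nonneg _))
  exact hW.setIntegral_sq_le (continuous_mollify hδ') (continuous_mollify hbδ')
    (abs_mollify_le hbδ hbδA) hb hφa har hr le_rfl

lemma ae_eq_zero (h : IsTransportSolution b δ) (hb : IsMonotoneSpeed b L)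
    (hδ : AEStronglyMeasurable δ) (hδA : ∀ z, |δ z| ≤ A) : ∀ᵐ z, z ∈ quadrant → δ z = 0 := by
  refine (isOpen_Ioi.prod isOpen_Ioi).ae_eq_zero_of_integral_contDiff_smul_eq_zero
    ((locallyIntegrable_of_abs_le hδ hδA).locallyIntegrableOn _) fun ψ hψ hψc hψq => ?_
  obtain ⟨a, r, ha, har, hbox⟩ := exists_box_of_isCompact hψc hψq
  have hψS : tsupport ψ ⊆ Icc a r ×ˢ Icc (-1) r :=
    hbox.trans (prod_mono_right (Icc_subset_Icc_left (by norm_num)))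
  have hB : IsCompact (Icc a (r + 1 + L * (r - -1)) ×ˢ Icc (-1) r) :=
    isCompact_Icc.prod isCompact_Icc
  have hrOut := tendsto_rOut_shrinkingBump (E := ℝ × ℝ)
  have hbound := (hrOut.eventually_lt_const ha).and (hrOut.eventually_le_const one_pos) |>.mono
    fun n hn => h.sq_integral_mul_mollify_le hb hδ hδA har (by linarith)
      (hψ.of_le (by norm_cast)) hψS hn.1 hn.2
  have hlim := (tendsto_integral_mul_mollify hδ hδA
    (hψ.continuous.integrable_of_hasCompactSupport hψc)).pow 2
  have hlim₀ := ((((tendsto_setIntegral_commutator hb.aestronglyMeasurable hb.norm_le hδ hδA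
    hB.measure_lt_top).const_mul
      (2 * (L * A * (r - -1)))).mul_const (r - -1)).const_mul
        (∫ z in Icc a r ×ˢ Icc (-1) r, fderiv ℝ ψ z (1, 0) ^ 2))
  have hsq : (∫ z, ψ z * δ z) ^ 2 ≤ 0 := by
    simpa using le_of_tendsto_of_tendsto hlim hlim₀ hbound
  exact pow_eq_zero_iff two_ne_zero |>.1 (hsq.antisymm (sq_nonneg _))

end IsTransportSolution

end Transport

section MeanSlope

variable {a : ℝ → ℝ}

/-- The mean of `a` over the segment from `p` to `q`. It is the difference quotient of a primitive
of `a`, written as an integral so that it is continuous across the diagonal `p = q`. -/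
noncomputable def meanSlope (a : ℝ → ℝ) (p q : ℝ) : ℝ := ∫ s in (0 : ℝ)..1, a (p + (q - p) * s)

lemma sub_mul_meanSlope (a : ℝ → ℝ) (p q : ℝ) : (q - p) * meanSlope a p q = ∫ x in p..q, a x := by
  rw [meanSlope, intervalIntegral.mul_integral_comp_add_mul]
  ring_nf

lemma meanSlope_nonneg (ha : ∀ x, 0 ≤ a x) (p q : ℝ) : 0 ≤ meanSlope a p q :=
  intervalIntegral.integral_nonneg zero_le_one fun _ _ => ha _

lemma continuous_meanSlope (ha : Continuous a) : Continuous fun z : ℝ × ℝ => meanSlope a z.1 z.2 :=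
  intervalIntegral.continuous_parametric_intervalIntegral_of_continuous' (by fun_prop) 0 1

lemma meanSlope_le_meanSlope (ha : Continuous a) (hmono : Monotone a) {p p' q q' : ℝ} (hp : p ≤ p')
    (hq : q ≤ q') : meanSlope a p q ≤ meanSlope a p' q' := by
  refine intervalIntegral.integral_mono_on zero_le_one
    (Continuous.intervalIntegrable (by fun_prop) 0 1)
    (Continuous.intervalIntegrable (by fun_prop) 0 1) fun s hs => hmono ?_
  have := mul_le_mul_of_nonneg_left hp (sub_nonneg.2 hs.2)
  have := mul_le_mul_of_nonneg_left hq hs.1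
  linarith

lemma integral_sqrt (p q : ℝ) : ∫ x in p..q, √x = flux p - flux q := by
  simp only [sqrt_eq_rpow]
  rw [integral_rpow (Or.inl (by norm_num)), flux, flux]
  norm_num
  ring

end MeanSlope

section Uniqueness

variable {m₀ : ℝ → ℝ} {m n k : ℝ × ℝ → ℝ} {M P : ℝ}

lemma flux_zero : flux 0 = 0 := by simp [flux]

/-- `n` is a density solution defined on the whole plane: it vanishes off the quadrant, takes
values in `[0, M]`, is nondecreasing in `x`, and has initial values `m₀`. -/
structure IsGlobalDensity (m₀ : ℝ → ℝ) (n : ℝ × ℝ → ℝ) (M : ℝ) : Prop where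
  aestronglyMeasurable : AEStronglyMeasurable n
  mem_Icc : ∀ z, n z ∈ Icc 0 M
  eq_zero : ∀ z ∉ quadrant, n z = 0
  mono : ∀ t, Monotone fun x => n (x, t)
  weak_eq : ∀ ψ, IsTestFunction ψ →
    ∫ q, (n q * fderiv ℝ ψ q (0, 1) + flux (n q) * fderiv ℝ ψ q (1, 0)) =
      -∫ x in Ioi (0 : ℝ), m₀ x * ψ (x, 0)

/-- The truncation of `m` at height `M`, extended by zero off the quadrant. -/
noncomputable def truncation (m : ℝ × ℝ → ℝ) (M : ℝ) : ℝ × ℝ → ℝ :=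
  indicator quadrant fun z => min (m z) M

lemma truncation_ae_eq (hM : ∀ᵐ z ∂volume.restrict quadrant, m z ≤ M) :
    truncation m M =ᵐ[volume.restrict quadrant] m := by
  filter_upwards [hM, ae_restrict_mem measurableSet_quadrant] with z hz hzq
  rw [truncation, indicator_of_mem hzq, min_eq_left hz]

lemma monotone_truncation (hm₀ : ∀ z ∈ quadrant, 0 ≤ m z)
    (hm : ∀ x t h : ℝ, 0 < x → 0 < t → 0 < h → m (x, t) ≤ m (x + h, t)) (hM : 0 ≤ M) (t : ℝ) :
    Monotone fun x => truncation m M (x, t) := fun x y hxy => by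
  have hnonneg : ∀ z, 0 ≤ truncation m M z :=
    indicator_nonneg fun z hz => le_min (hm₀ z hz) hM
  by_cases hx : (x, t) ∈ quadrant
  · have hy : (y, t) ∈ quadrant := ⟨hx.1.trans_le hxy, hx.2⟩
    simp only [truncation, indicator_of_mem hx, indicator_of_mem hy]
    rcases hxy.eq_or_lt with rfl | h
    · exact le_rfl
    · have := hm x t (y - x) hx.1 hx.2 (sub_pos.2 h)
      rw [add_sub_cancel] at this
      exact min_le_min_right M this
  · exact (indicator_of_notMem hx _).trans_le (hnonneg _)

lemma IsPositiveDensitySolution.isGlobalDensity_truncation (hm : IsPositiveDensitySolution m₀ m)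
    (hM : 0 ≤ M) (hmM : ∀ᵐ z ∂volume.restrict quadrant, m z ≤ M) :
    IsGlobalDensity m₀ (truncation m M) M where
  aestronglyMeasurable := (aestronglyMeasurable_indicator_iff measurableSet_quadrant).2
    (hm.isWeakSolution.memLp.1.inf aestronglyMeasurable_const)
  mem_Icc z := ⟨indicator_nonneg (fun q hq => le_min (hm.isWeakSolution.nonneg q hq) hM) z,
    indicator_le' (fun q _ => min_le_right _ _) (fun _ _ => hM) z⟩
  eq_zero z hz := indicator_of_notMem hz _
  mono := monotone_truncation hm.isWeakSolution.nonneg hm.mono hM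
  weak_eq ψ hψ := by
    rw [← setIntegral_eq_integral_of_forall_compl_eq_zero (s := quadrant) fun z hz => by
      simp [truncation, indicator_of_notMem hz, flux_zero], eq_neg_iff_add_eq_zero]
    refine Eq.trans ?_ (hm.isWeakSolution.weak_eq ψ hψ)
    congr 1
    refine integral_congr_ae ?_
    filter_upwards [truncation_ae_eq hmM] with z hz
    rw [hz, deriv_fst_slice hψ.differentiable, deriv_snd_slice hψ.differentiable]

lemma IsTestFunction.integrable_mul_fderiv {ψ f : ℝ × ℝ → ℝ} (hψ : IsTestFunction ψ)
    (hf : LocallyIntegrable f) (e : ℝ × ℝ) : Integrable fun z => f z * fderiv ℝ ψ z e :=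
  hf.integrable_smul_right_of_hasCompactSupport
    ((hψ.smooth.continuous_fderiv (by simp)).clm_apply continuous_const)
    (hψ.compactSupport.fderiv_apply (𝕜 := ℝ) e)

namespace IsGlobalDensity

lemma locallyIntegrable (hn : IsGlobalDensity m₀ n M) : LocallyIntegrable n :=
  locallyIntegrable_of_abs_le hn.aestronglyMeasurable fun z =>
    (abs_of_nonneg (hn.mem_Icc z).1).trans_le (hn.mem_Icc z).2

lemma locallyIntegrable_flux (hn : IsGlobalDensity m₀ n M) :
    LocallyIntegrable fun z => flux (n z) := by
  obtain ⟨A, hA⟩ := isCompact_Icc.exists_bound_of_continuousOn continuous_flux.continuousOn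
  exact locallyIntegrable_of_abs_le (continuous_flux.comp_aestronglyMeasurable
    hn.aestronglyMeasurable) fun z => hA _ (hn.mem_Icc z)

lemma isMonotoneSpeed_meanSlope (hn : IsGlobalDensity m₀ n M) (hk : IsGlobalDensity m₀ k P) :
    IsMonotoneSpeed (fun z => meanSlope sqrt (k z) (n z)) (meanSlope sqrt P M) where
  aestronglyMeasurable := (continuous_meanSlope continuous_sqrt).comp_aestronglyMeasurable
    (hk.aestronglyMeasurable.prodMk hn.aestronglyMeasurable)
  mono t _ _ hxy := meanSlope_le_meanSlope continuous_sqrt sqrt_monotone (hk.mono t hxy)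
    (hn.mono t hxy)
  nonneg _ := meanSlope_nonneg sqrt_nonneg _ _
  le z := meanSlope_le_meanSlope continuous_sqrt sqrt_monotone (hk.mem_Icc z).2 (hn.mem_Icc z).2

lemma isTransportSolution_sub (hn : IsGlobalDensity m₀ n M) (hk : IsGlobalDensity m₀ k P) :
    IsTransportSolution (fun z => meanSlope sqrt (k z) (n z)) (n - k) where
  eq_zero z hz := by
    have hzq : z ∉ quadrant := fun h => hz.not_gt h.2
    rw [Pi.sub_apply, hn.eq_zero z hzq, hk.eq_zero z hzq, sub_zero]
  weak_eq ψ hψ := by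
    have hflux : ∀ z, meanSlope sqrt (k z) (n z) * (n z - k z) = flux (k z) - flux (n z) :=
      fun z => by rw [mul_comm, sub_mul_meanSlope, integral_sqrt]
    have hn_t := hψ.integrable_mul_fderiv hn.locallyIntegrable (0, 1)
    have hk_t := hψ.integrable_mul_fderiv hk.locallyIntegrable (0, 1)
    have hn_x := hψ.integrable_mul_fderiv hn.locallyIntegrable_flux (1, 0)
    have hk_x := hψ.integrable_mul_fderiv hk.locallyIntegrable_flux (1, 0)
    have hsame := (hn.weak_eq ψ hψ).trans (hk.weak_eq ψ hψ).symm
    rw [integral_add hn_t hn_x, integral_add hk_t hk_x] at hsame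
    simp only [Pi.mul_apply, Pi.sub_apply, hflux, sub_mul]
    rw [integral_sub hn_t hk_t, integral_sub hk_x hn_x]
    linarith

lemma ae_eq (hn : IsGlobalDensity m₀ n M) (hk : IsGlobalDensity m₀ k P) :
    n =ᵐ[volume.restrict quadrant] k := by
  have hbound : ∀ z, |(n - k) z| ≤ M + P := fun z =>
    norm_sub_le_of_le ((norm_of_nonneg (hn.mem_Icc z).1).trans_le (hn.mem_Icc z).2)
      ((norm_of_nonneg (hk.mem_Icc z).1).trans_le (hk.mem_Icc z).2)
  have hzero := (hn.isTransportSolution_sub hk).ae_eq_zero (hn.isMonotoneSpeed_meanSlope hk)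
    (hn.aestronglyMeasurable.sub hk.aestronglyMeasurable) hbound
  filter_upwards [(ae_restrict_iff' measurableSet_quadrant).2 hzero] with z hz
    using sub_eq_zero.1 hz

end IsGlobalDensity

lemma ae_le_lpNorm_top (hm : MemLp m ⊤ (volume.restrict quadrant)) :
    ∀ᵐ z ∂volume.restrict quadrant, m z ≤ lpNorm m ⊤ (volume.restrict quadrant) :=
  (ae_le_lpNorm_exponent_top hm).mono fun _ hz => (le_abs_self _).trans hz

theorem IsPositiveDensitySolution.ae_eq {m' : ℝ × ℝ → ℝ}
    (hm : IsPositiveDensitySolution m₀ m) (hm' : IsPositiveDensitySolution m₀ m') :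
    m =ᵐ[volume.restrict quadrant] m' := by
  have hM := ae_le_lpNorm_top hm.isWeakSolution.memLp
  have hM' := ae_le_lpNorm_top hm'.isWeakSolution.memLp
  have htrunc := (hm.isGlobalDensity_truncation lpNorm_nonneg hM).ae_eq
    (hm'.isGlobalDensity_truncation lpNorm_nonneg hM')
  exact (truncation_ae_eq hM).symm.trans (htrunc.trans (truncation_ae_eq hM'))

end Uniqueness

end ShellCrossing

theorem proposition2 (m₀ : ℝ → ℝ)
    (hm₀_bdd : MemLp m₀ ⊤ (volume.restrict (Ioi (0 : ℝ))))
    (hm₀_nonneg : ∀ x : ℝ, 0 < x → 0 ≤ m₀ x)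
    (hm₀_mono : ∀ x h : ℝ, 0 < x → 0 < h → m₀ x ≤ m₀ (x + h)) :
    ∃ m : ℝ × ℝ → ℝ, ShellCrossing.IsPositiveDensitySolution m₀ m ∧
      ∀ m' : ℝ × ℝ → ℝ, ShellCrossing.IsPositiveDensitySolution m₀ m' →
        m' =ᵐ[volume.restrict ShellCrossing.quadrant] m := by
  obtain ⟨m, hm⟩ :=
    ShellCrossing.exists_isPositiveDensitySolution hm₀_bdd hm₀_nonneg hm₀_mono
  exact ⟨m, hm, fun m' hm' => hm'.ae_eq hm⟩
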